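/- Let $s>0$ and let $S^2=\{(S_1,S_2,S_3)\in\mathbb R^3 : S_1^2+S_2^2+S_3^2=s^2\}$. Let $\mathcal P=\mathbb R[S_1,S_2,S_3]/(S_1^2+S_2^2+S_3^2-s^2)$ be the algebra of real polynomials in $S_1,S_2,S_3$ restricted to $S^2$, with the Poisson bracket $$\{f,g\}=\sum_{i,j,k=1}^3\epsilon_{ijk}\,S_i\,\frac{\partial f}{\partial S_j}\,\frac{\partial g}{\partial S_k},$$ which is well defined on $\mathcal P$. A Poisson subalgebra of $\mathcal P$ is a real linear subspace of $\mathcal P$ that is closed under $\{\cdot,\cdot\}$ (closure under multiplication is not required). Let $\mathcal P^1\subset\mathcal P$ be the subspace of elements that have a polynomial representative of degree at most $1$, let $\mathcal O\subset\mathcal P$ be the subspace of elements that have a polynomial representative all of whose terms are of odd degree, and let $\widetilde{\mathcal O}=\mathcal O\oplus\mathbb R$, where $\mathbb R$ denotes the constants. Lemma. Every Poisson subalgebra of $\mathcal P$ that strictly contains $\mathcal P^1$ also contains $\widetilde{\mathcal O}$. -/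

import Mathlib

namespace SpinSphere

open MvPolynomial

/-- The polynomial bracket `{f, g} = ∑ ε_{ijk} S_i (∂f/∂S_j) (∂g/∂S_k)` on `ℝ[S₁, S₂, S₃]`,
written out over the six nonzero values of `ε`; the indices `0, 1, 2` stand for `1, 2, 3`. -/
noncomputable def polyBracket (f g : MvPolynomial (Fin 3) ℝ) : MvPolynomial (Fin 3) ℝ :=
  X 0 * (pderiv 1 f * pderiv 2 g - pderiv 2 f * pderiv 1 g) +
  X 1 * (pderiv 2 f * pderiv 0 g - pderiv 0 f * pderiv 2 g) +
  X 2 * (pderiv 0 f * pderiv 1 g - pderiv 1 f * pderiv 0 g)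

/-- The polynomial `S₁² + S₂² + S₃² - s²`, whose zero set is the sphere of radius `s`. -/
noncomputable def spherePoly (s : ℝ) : MvPolynomial (Fin 3) ℝ :=
  X 0 ^ 2 + X 1 ^ 2 + X 2 ^ 2 - C (s ^ 2)

/-- The ideal of relations generated by `S₁² + S₂² + S₃² = s²`. -/
noncomputable def sphereIdeal (s : ℝ) : Ideal (MvPolynomial (Fin 3) ℝ) :=
  Ideal.span {spherePoly s}

/-- The algebra `𝒫` of polynomials in `S₁, S₂, S₃` modulo `S₁² + S₂² + S₃² = s²`. -/
abbrev SpherePolynomial (s : ℝ) : Type :=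
  MvPolynomial (Fin 3) ℝ ⧸ sphereIdeal s

/-- The quotient map `ℝ[S₁, S₂, S₃] → 𝒫`, as a homomorphism of real algebras. -/
noncomputable abbrev toSphere (s : ℝ) : MvPolynomial (Fin 3) ℝ →ₐ[ℝ] SpherePolynomial s :=
  Ideal.Quotient.mkₐ ℝ (sphereIdeal s)

theorem polyBracket_mem (s : ℝ) {f f' g g' : MvPolynomial (Fin 3) ℝ}
    (hf : f - f' ∈ sphereIdeal s) (hg : g - g' ∈ sphereIdeal s) :
    polyBracket f g - polyBracket f' g' ∈ sphereIdeal s := by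
  obtain ⟨a, ha⟩ := Ideal.mem_span_singleton'.1 hf
  obtain ⟨b, hb⟩ := Ideal.mem_span_singleton'.1 hg
  obtain rfl : f = f' + a * spherePoly s := by rw [ha]; ring
  obtain rfl : g = g' + b * spherePoly s := by rw [hb]; ring
  refine Ideal.mem_span_singleton'.2
    ⟨polyBracket f' b + polyBracket a g' + spherePoly s * polyBracket a b, ?_⟩
  simp only [polyBracket, spherePoly, map_add, map_sub, Derivation.leibniz, smul_eq_mul,
    Derivation.leibniz_pow, pderiv_X, pderiv_C, Pi.single_apply]
  simp
  ring

/-- The Poisson bracket of `𝒫`: the bracket of the classes of `f` and `g` is the class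
of `∑ ε_{ijk} S_i (∂f/∂S_j) (∂g/∂S_k)`. -/
noncomputable def poissonBracket (s : ℝ) :
    SpherePolynomial s → SpherePolynomial s → SpherePolynomial s :=
  fun p q => Quotient.liftOn₂' p q (fun f g => toSphere s (polyBracket f g)) (by
    intro f g f' g' hf hg
    exact (Ideal.Quotient.mk_eq_mk_iff_sub_mem _ _).2
      (polyBracket_mem s ((Submodule.quotientRel_def _).1 hf)
        ((Submodule.quotientRel_def _).1 hg)))

theorem poissonBracket_toSphere (s : ℝ) (f g : MvPolynomial (Fin 3) ℝ) :
    poissonBracket s (toSphere s f) (toSphere s g) = toSphere s (polyBracket f g) := rfl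

/-- A Poisson subalgebra of `𝒫` is a real linear subspace closed under the Poisson bracket.
(Closure under the pointwise product is not required: `𝒫¹` is a Poisson subalgebra.) -/
def IsPoissonSubalgebra (s : ℝ) (A : Submodule ℝ (SpherePolynomial s)) : Prop :=
  ∀ p ∈ A, ∀ q ∈ A, poissonBracket s p q ∈ A

/-- The subspace `𝒫ᵏ` of elements of degree at most `k`, that is, of those classes which have a
polynomial representative of total degree at most `k`. -/
noncomputable def degreeLE (s : ℝ) (k : ℕ) : Submodule ℝ (SpherePolynomial s) :=
  (MvPolynomial.restrictTotalDegree (Fin 3) ℝ k).map (toSphere s).toLinearMap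

/-- The polynomials in `S₁, S₂, S₃` all of whose terms have odd degree. -/
def oddPoly : Submodule ℝ (MvPolynomial (Fin 3) ℝ) where
  carrier := {f | ∀ d ∈ f.support, Odd d.degree}
  zero_mem' := by simp
  add_mem' := by
    intro f g hf hg d hd
    rcases Finset.mem_union.1 (MvPolynomial.support_add hd) with h | h
    · exact hf d h
    · exact hg d h
  smul_mem' := by
    intro c f hf d hd
    exact hf d (MvPolynomial.support_smul hd)

/-- The subspace `𝒪` of `𝒫` consisting of the classes of odd polynomials. -/
noncomputable def oddPart (s : ℝ) : Submodule ℝ (SpherePolynomial s) :=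
  oddPoly.map (toSphere s).toLinearMap

/-- The subspace `Õ = 𝒪 ⊕ ℝ` of `𝒫`, where `ℝ` denotes the constants. -/
noncomputable def oddTilde (s : ℝ) : Submodule ℝ (SpherePolynomial s) :=
  oddPart s ⊔ Submodule.span ℝ {1}

end SpinSphere

/-! Complexify and use ladder operators: `u = S₁ + iS₂`, `v = S₁ - iS₂`, `w = S₃`, with the bracket
scaled by `i`, satisfy the `sl₂` relations. Everything is done in the polynomial ring, modulo the
relation `uv = W`, where `W = c - w²` and `c = s²`.

An element of `A` outside `𝒫¹` splits into `ad w`-weight vectors `u^m q(w)` or `v^m q(w)`, all in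
`A`. One of them is outside `𝒫¹`, and bracketing it `m` times with the opposite ladder element gives
a polynomial in `w` of degree at least 2 (`exists_aeval_mem_of_not_mem`).

From a polynomial in `w` of degree `n + 1`, iterating `ad u` and `ad v` gives `u^(n+1)` and
`v^(n+1)`, whose bracket is a multiple of `w W^n`, of degree `2n + 1`. So degrees grow without bound
(`exists_aeval_mem_natDegree_ge`). Conversely `ad v ∘ ad u` takes `w W^(k+1)` to a combination of
itself and `w W^k`, so every `w W^k` is reached by descent (`mul_pow_mem_of_succ`). These give all
odd powers of `w`, then all odd monomials in `u`, `v`, `w` (`odd_monomial_mem`). -/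

/-- `br` is a skew biderivation of `R`, the elements `u`, `v`, `w` span a copy of `sl₂` for it, and
`A` is a subspace closed under `br` which contains `u`, `v`, `w` and all multiples of
`u v + w² - c`. -/
structure IsSphereSubalgebra {R : Type*} [CommRing R] [Algebra ℂ R]
    (br : R → Derivation ℂ R R) (c : ℂ) (A : Submodule ℂ R) (u v w : R) : Prop where
  skew : ∀ x y, br x y = -br y x
  closed : ∀ x ∈ A, ∀ y ∈ A, br x y ∈ A
  u_mem : u ∈ A
  v_mem : v ∈ A
  w_mem : w ∈ A
  rel_mem : ∀ x, x * (u * v - (algebraMap ℂ R c - w ^ 2)) ∈ A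
  br_w_u : br w u = u
  br_w_v : br w v = -v
  br_u_v : br u v = 2 * w
  ne_zero : c ≠ 0

/-- A submodule invariant under an endomorphism contains the eigenvector components, for distinct
eigenvalues, of each of its elements. -/
theorem Submodule.mem_of_sum_eigenvectors_mem {K V ι : Type*} [Field K] [AddCommGroup V]
    [Module K V] (T : V →ₗ[K] V) (A : Submodule K V) (hT : ∀ x ∈ A, T x ∈ A) (μ : ι → K)
    (hμ : Function.Injective μ) (s : Finset ι) :
    ∀ x : ι → V, (∀ i ∈ s, T (x i) = μ i • x i) → ∑ i ∈ s, x i ∈ A → ∀ i ∈ s, x i ∈ A := by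
  classical
  induction s using Finset.induction_on with
  | empty => simp
  | insert a s ha ih =>
    intro x hx hsum
    have hs : ∀ i ∈ s, x i ∈ A := by
      intro i hi
      -- Applying `T - μ a` kills the `a`-component and rescales the others by nonzero factors.
      have key : ∑ i ∈ s, (μ i - μ a) • x i ∈ A := by
        have h1 := A.sub_mem (hT _ hsum) (A.smul_mem (μ a) hsum)
        rw [map_sum, Finset.smul_sum, ← Finset.sum_sub_distrib, Finset.sum_insert ha,
          hx a (Finset.mem_insert_self _ _), sub_self, zero_add] at h1
        convert h1 using 1
        refine Finset.sum_congr rfl fun j hj => ?_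
        rw [hx j (Finset.mem_insert_of_mem hj), sub_smul]
      have h2 := ih (fun i => (μ i - μ a) • x i) (fun j hj => by
        simp only [map_smul]
        rw [hx j (Finset.mem_insert_of_mem hj), smul_comm]) key i hi
      refine (A.smul_mem_iff (sub_ne_zero.2 fun h => ha ?_)).1 h2
      exact hμ h ▸ hi
    intro i hi
    rcases Finset.mem_insert.1 hi with rfl | hi
    · rw [Finset.sum_insert ha] at hsum
      exact (A.add_mem_iff_left (A.sum_mem hs)).1 hsum
    · exact hs i hi

namespace IsSphereSubalgebra

open Polynomial

variable {R : Type*} [CommRing R] [Algebra ℂ R] {br : R → Derivation ℂ R R} {c : ℂ}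
  {A : Submodule ℂ R} {u v w : R}

theorem br_self (h : IsSphereSubalgebra br c A u v w) (x : R) : br x x = 0 := by
  have h1 : (2 : ℂ) • br x x = 0 := by
    rw [two_smul]
    nth_rewrite 1 [h.skew x x]
    simp
  exact (smul_eq_zero_iff_right (two_ne_zero)).1 h1

theorem br_u_w (h : IsSphereSubalgebra br c A u v w) : br u w = -u := by
  rw [h.skew, h.br_w_u]

theorem br_v_w (h : IsSphereSubalgebra br c A u v w) : br v w = v := by
  rw [h.skew, h.br_w_v, neg_neg]

theorem br_v_u (h : IsSphereSubalgebra br c A u v w) : br v u = -(2 * w) := by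
  rw [h.skew, h.br_u_v]

/-- This symmetry transfers each statement about `u` to `v`; polynomials in `w` are then composed
with `-X`. -/
theorem swap (h : IsSphereSubalgebra br c A u v w) : IsSphereSubalgebra br c A v u (-w) where
  skew := h.skew
  closed := h.closed
  u_mem := h.v_mem
  v_mem := h.u_mem
  w_mem := A.neg_mem h.w_mem
  rel_mem x := by
    convert h.rel_mem x using 1
    ring
  br_w_u := by rw [h.skew, map_neg, h.br_v_w, neg_neg]
  br_w_v := by rw [h.skew, map_neg, h.br_u_w, neg_neg]
  br_u_v := by rw [h.br_v_u]; ring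
  ne_zero := h.ne_zero

theorem mem_of_dvd_sub (h : IsSphereSubalgebra br c A u v w) {x y : R} (hx : x ∈ A)
    (hxy : u * v - (algebraMap ℂ R c - w ^ 2) ∣ x - y) : y ∈ A := by
  obtain ⟨z, hz⟩ := hxy
  have h1 := A.sub_mem hx (h.rel_mem z)
  rwa [mul_comm z, ← hz, sub_sub_cancel] at h1

theorem mem_of_natCast_mul_mem (A : Submodule ℂ R) {n : ℕ} (hn : n ≠ 0) {x : R}
    (hx : (n : R) * x ∈ A) : x ∈ A := by
  have h1 : ((n : ℂ) • x) ∈ A := by rwa [Algebra.smul_def, map_natCast]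
  exact (A.smul_mem_iff (Nat.cast_ne_zero.2 hn)).1 h1

theorem natCast_mul_mem (A : Submodule ℂ R) (n : ℕ) {x : R}
    (hx : x ∈ A) : (n : R) * x ∈ A := by
  rw [← nsmul_eq_mul]
  exact A.nsmul_mem hx n

/-! ### From one polynomial in `w` to all odd monomials. -/

theorem br_u_pow_mul_aeval (h : IsSphereSubalgebra br c A u v w) (m : ℕ) (q : ℂ[X]) :
    br u (u ^ m * aeval w q) = -(u ^ (m + 1) * aeval w (derivative q)) := by
  simp only [Derivation.leibniz, Derivation.leibniz_pow, h.br_self, Derivation.map_aeval,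
    smul_eq_mul, h.br_u_w]
  ring

theorem pow_mul_aeval_iterate_derivative_mem (h : IsSphereSubalgebra br c A u v w) (m : ℕ)
    {q : ℂ[X]} (hq : aeval w q ∈ A) : u ^ m * aeval w (derivative^[m] q) ∈ A := by
  induction m with
  | zero => simpa using hq
  | succ m ih =>
    have h1 := h.closed _ h.u_mem _ ih
    rwa [h.br_u_pow_mul_aeval, A.neg_mem_iff, ← Function.iterate_succ_apply' derivative m q] at h1

/-- Up to sign, each `ad u` differentiates `q` and adds a factor `u`; after `natDegree` steps only a
nonzero constant is left of `q`. -/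
theorem pow_natDegree_mem (h : IsSphereSubalgebra br c A u v w) {q : ℂ[X]} (hq0 : q ≠ 0)
    (hq : aeval w q ∈ A) : u ^ q.natDegree ∈ A := by
  have h1 := h.pow_mul_aeval_iterate_derivative_mem q.natDegree hq
  have h2 : derivative^[q.natDegree] q = C ((q.natDegree.factorial : ℂ) * q.leadingCoeff) := by
    have h3 := natDegree_iterate_derivative q q.natDegree
    rw [Nat.sub_self] at h3
    rw [eq_C_of_natDegree_le_zero h3, coeff_iterate_derivative]
    simp [Nat.descFactorial_self]
  rw [h2, aeval_C, mul_comm, ← Algebra.smul_def] at h1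
  refine (A.smul_mem_iff (mul_ne_zero ?_ (leadingCoeff_ne_zero.2 hq0))).1 h1
  exact_mod_cast Nat.factorial_ne_zero _

theorem pow_natDegree_mem' (h : IsSphereSubalgebra br c A u v w) {q : ℂ[X]} (hq0 : q ≠ 0)
    (hq : aeval w q ∈ A) : v ^ q.natDegree ∈ A := by
  have h1 := h.swap.pow_natDegree_mem (q := q.comp (-X)) (by
    intro h0
    apply hq0
    simpa [Polynomial.comp_assoc] using congrArg (fun p => p.comp (-X)) h0) (by
      simpa [Polynomial.aeval_comp] using hq)
  simpa [Polynomial.natDegree_comp] using h1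

theorem mul_pow_mem (h : IsSphereSubalgebra br c A u v w) {n : ℕ} (hu : u ^ (n + 1) ∈ A)
    (hv : v ^ (n + 1) ∈ A) : w * (algebraMap ℂ R c - w ^ 2) ^ n ∈ A := by
  have h1 := h.closed _ hu _ hv
  have h2 : br (u ^ (n + 1)) (v ^ (n + 1)) =
      ((2 * (n + 1) ^ 2 : ℕ) : R) * (w * (u * v) ^ n) := by
    rw [Derivation.leibniz_pow, h.skew, Derivation.leibniz_pow, h.br_v_u]
    simp only [smul_eq_mul, nsmul_eq_mul, add_tsub_cancel_right]
    push_cast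
    ring
  rw [h2] at h1
  refine h.mem_of_dvd_sub (mem_of_natCast_mul_mem A (by positivity) h1) ?_
  rw [← mul_sub]
  exact (sub_dvd_pow_sub_pow _ _ n).mul_left w

/-- Modulo the relation, `ad v ∘ ad u` maps `w W^(k+1)` to a multiple of itself minus `4(k+1)²c · w
W^k`. The second coefficient is nonzero because `c ≠ 0`. -/
theorem mul_pow_mem_of_succ (h : IsSphereSubalgebra br c A u v w) {k : ℕ}
    (hk : w * (algebraMap ℂ R c - w ^ 2) ^ (k + 1) ∈ A) :
    w * (algebraMap ℂ R c - w ^ 2) ^ k ∈ A := by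
  set W := algebraMap ℂ R c - w ^ 2 with hW
  have hw2 : w ^ 2 = algebraMap ℂ R c - W := by rw [hW]; ring
  have huW : br u W = 2 * w * u := by
    simp only [hW, map_sub, Derivation.map_algebraMap, Derivation.leibniz_pow, h.br_u_w,
      smul_eq_mul, nsmul_eq_mul]
    push_cast
    ring
  have hvW : br v W = -(2 * w * v) := by
    simp only [hW, map_sub, Derivation.map_algebraMap, Derivation.leibniz_pow, h.br_v_w,
      smul_eq_mul, nsmul_eq_mul]
    push_cast
    ring
  have h1 : br u (w * W ^ (k + 1)) =
      u * (algebraMap ℂ R (2 * (k + 1) * c) * W ^ k - algebraMap ℂ R (2 * k + 3) * W ^ (k + 1)) := by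
    simp only [Derivation.leibniz, Derivation.leibniz_pow, huW, h.br_u_w,
      smul_eq_mul, nsmul_eq_mul, add_tsub_cancel_right, map_mul, map_add, map_natCast, map_one,
      map_ofNat]
    push_cast
    linear_combination (2 * (k + 1) * W ^ k * u) * hw2
  have h2 := h.closed _ h.v_mem _ (h.closed _ h.u_mem _ hk)
  have h3 : br v (br u (w * W ^ (k + 1))) -
      ((((4 * k + 6) * (k + 2) : ℕ) : R) * (w * W ^ (k + 1)) -
        ((4 * (k + 1) ^ 2 : ℕ) : R) * (algebraMap ℂ R c * (w * W ^ k))) =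
      (u * v - W) * (2 * w * ((2 * k + 3) * (k + 1) * W ^ k
        - 2 * (k + 1) * k * algebraMap ℂ R c * W ^ (k - 1))) := by
    -- The truncated exponent at `k = 0` is harmless, since the factor `k` vanishes there.
    have hk' : (k : R) * W ^ k = k * W ^ (k - 1) * W := by
      cases k with
      | zero => simp
      | succ k => simp [pow_succ, mul_assoc]
    rw [h1]
    simp only [Derivation.leibniz, Derivation.leibniz_pow, hvW, h.br_v_u, map_sub,
      Derivation.map_algebraMap, smul_eq_mul, nsmul_eq_mul, add_tsub_cancel_right]
    simp only [map_mul, map_add, map_natCast, map_one, map_ofNat]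
    push_cast
    linear_combination (4 * w * (k + 1) * algebraMap ℂ R c) * hk'
  have h4 := h.mem_of_dvd_sub h2 ⟨_, h3⟩
  have h5 := (A.sub_mem_iff_right (natCast_mul_mem A _ hk)).1 h4
  have h6 := mem_of_natCast_mul_mem A (by positivity) h5
  rw [← Algebra.smul_def] at h6
  exact (A.smul_mem_iff h.ne_zero).1 h6

/-- The degree passes from `n + 1` to `2n + 1`, a strict increase exactly when `n ≥ 1`; hence the
bound 2. -/
theorem exists_aeval_mem_natDegree_ge (h : IsSphereSubalgebra br c A u v w) {q : ℂ[X]}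
    (hq : aeval w q ∈ A) (hd : 2 ≤ q.natDegree) (N : ℕ) :
    ∃ p : ℂ[X], aeval w p ∈ A ∧ 2 ≤ p.natDegree ∧ N ≤ p.natDegree := by
  induction N with
  | zero => exact ⟨q, hq, hd, Nat.zero_le _⟩
  | succ N ih =>
    obtain ⟨p, hp, hp2, hpN⟩ := ih
    have hp0 : p ≠ 0 := by rintro rfl; simp at hp2
    obtain ⟨n, hn⟩ : ∃ n, p.natDegree = n + 1 := ⟨p.natDegree - 1, by omega⟩
    have hu := h.pow_natDegree_mem hp0 hp
    have hv := h.pow_natDegree_mem' hp0 hp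
    rw [hn] at hu hv
    have hdeg : (X * (C c - X ^ 2) ^ n : ℂ[X]).natDegree = 2 * n + 1 := by
      have h2 : (C c - X ^ 2 : ℂ[X]).natDegree = 2 := by compute_degree!
      have h0 : (C c - X ^ 2 : ℂ[X]) ≠ 0 := by
        intro h0; simp [h0] at h2
      rw [natDegree_mul X_ne_zero (pow_ne_zero _ h0), natDegree_pow, h2, natDegree_X]
      ring
    refine ⟨X * (C c - X ^ 2) ^ n, ?_, by omega, by omega⟩
    simpa using h.mul_pow_mem hu hv

theorem mul_pow_mem_of_natDegree (h : IsSphereSubalgebra br c A u v w) {q : ℂ[X]}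
    (hq : aeval w q ∈ A) (hd : 2 ≤ q.natDegree) (k : ℕ) :
    w * (algebraMap ℂ R c - w ^ 2) ^ k ∈ A := by
  obtain ⟨p, hp, hp2, hpN⟩ := h.exists_aeval_mem_natDegree_ge hq hd (k + 1)
  have hp0 : p ≠ 0 := by rintro rfl; simp at hp2
  obtain ⟨n, hn⟩ : ∃ n, p.natDegree = n + 1 := ⟨p.natDegree - 1, by omega⟩
  have hu := h.pow_natDegree_mem hp0 hp
  have hv := h.pow_natDegree_mem' hp0 hp
  rw [hn] at hu hv
  have hkn : k ≤ n := by omega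
  exact Nat.decreasingInduction (motive := fun j _ => w * (algebraMap ℂ R c - w ^ 2) ^ j ∈ A)
    (fun j _ hj => h.mul_pow_mem_of_succ hj) (h.mul_pow_mem hu hv) hkn

theorem odd_pow_mem (h : IsSphereSubalgebra br c A u v w) {q : ℂ[X]}
    (hq : aeval w q ∈ A) (hd : 2 ≤ q.natDegree) {n : ℕ} (hn : Odd n) : w ^ n ∈ A := by
  obtain ⟨k, rfl⟩ := hn
  -- Keeping `j` free lets `w² = c - W` trade two powers of `w` for one of `W`.
  have key : ∀ j, w ^ (2 * k + 1) * (algebraMap ℂ R c - w ^ 2) ^ j ∈ A := by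
    induction k with
    | zero => simpa using h.mul_pow_mem_of_natDegree hq hd
    | succ k ih =>
      intro j
      have h1 := A.sub_mem (A.smul_mem c (ih j)) (ih (j + 1))
      convert h1 using 1
      rw [Algebra.smul_def]
      ring
  simpa using key 0

/-- Each `ad u` turns one `w` into a `u`, up to a nonzero factor, and keeps the total degree. -/
theorem pow_mul_pow_mem (h : IsSphereSubalgebra br c A u v w) {q : ℂ[X]}
    (hq : aeval w q ∈ A) (hd : 2 ≤ q.natDegree) (m : ℕ) :
    ∀ k, Odd (m + k) → u ^ m * w ^ k ∈ A := by
  induction m with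
  | zero => intro k hk; simpa using h.odd_pow_mem hq hd (by simpa using hk)
  | succ m ih =>
    intro k hk
    have h1 := h.closed _ h.u_mem _ (ih (k + 1) (by convert hk using 1; ring))
    have h2 : br u (u ^ m * w ^ (k + 1)) = -(((k + 1 : ℕ) : R) * (u ^ (m + 1) * w ^ k)) := by
      simp only [Derivation.leibniz, Derivation.leibniz_pow, h.br_self, smul_eq_mul,
        nsmul_eq_mul, h.br_u_w, add_tsub_cancel_right]
      ring
    rw [h2, A.neg_mem_iff] at h1
    exact mem_of_natCast_mul_mem A (by positivity) h1

theorem pow_mul_pow_mem' (h : IsSphereSubalgebra br c A u v w) {q : ℂ[X]}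
    (hq : aeval w q ∈ A) (hd : 2 ≤ q.natDegree) (m k : ℕ) (hmk : Odd (m + k)) :
    v ^ m * w ^ k ∈ A := by
  have h1 := h.swap.pow_mul_pow_mem (q := q.comp (-X))
    (by simpa [Polynomial.aeval_comp] using hq) (by simpa [Polynomial.natDegree_comp] using hd)
    m k hmk
  rcases Nat.even_or_odd k with hk | hk
  · rwa [hk.neg_pow] at h1
  · rwa [hk.neg_pow, mul_neg, A.neg_mem_iff] at h1

/-- Replacing `uv` by `c - w²` preserves the parity of the degree, so mixed monomials reduce to pure
ones. -/
theorem odd_monomial_mem (h : IsSphereSubalgebra br c A u v w) {q : ℂ[X]}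
    (hq : aeval w q ∈ A) (hd : 2 ≤ q.natDegree) (a : ℕ) :
    ∀ b k, Odd (a + b + k) → u ^ a * v ^ b * w ^ k ∈ A := by
  induction a with
  | zero => intro b k hk; simpa using h.pow_mul_pow_mem' hq hd b k (by simpa using hk)
  | succ a ih =>
    intro b k hk
    cases b with
    | zero => simpa using h.pow_mul_pow_mem hq hd (a + 1) k (by simpa using hk)
    | succ b =>
      have h1 := A.sub_mem (A.smul_mem c (ih b k (by
        rw [show a + 1 + (b + 1) + k = a + b + k + 2 by ring] at hk
        simpa [Nat.odd_add] using hk))) (ih b (k + 2) (by convert hk using 1; ring))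
      refine h.mem_of_dvd_sub h1 ⟨-(u ^ a * v ^ b * w ^ k), ?_⟩
      rw [Algebra.smul_def]
      ring

/-! ### Weight decomposition and extraction of a polynomial in `w`. -/

theorem exists_aeval_mem_of_pow_mul (h : IsSphereSubalgebra br c A u v w) (m : ℕ) :
    ∀ {q : ℂ[X]}, q ≠ 0 → u ^ m * aeval w q ∈ A →
      ∃ p : ℂ[X], aeval w p ∈ A ∧ p.natDegree = m + q.natDegree := by
  induction m with
  | zero => intro q _ hq; exact ⟨q, by simpa using hq, by simp⟩
  | succ m ih =>
    intro q hq0 hq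
    -- Modulo the relation, `br v (u^(m+1) q(w))` is `u^m p(w)`. Both terms of `p` contribute to the
    -- top coefficient with the same sign, so it does not cancel: the degree rises by one as `m`
    -- drops by one.
    set p : ℂ[X] := (C c - X ^ 2) * derivative q - C (2 * (m + 1) : ℂ) * (X * q) with hp
    have hcoeff (n : ℕ) : p.coeff (n + 1) =
        c * (q.coeff (n + 2) * (n + 2)) - ((2 * (m + 1) + n : ℕ) : ℂ) * q.coeff n := by
      have h1 : p = C c * derivative q - X * (X * derivative q)
          - C (2 * (m + 1) : ℂ) * (X * q) := by rw [hp]; ring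
      rw [h1, coeff_sub, coeff_sub, coeff_C_mul, coeff_C_mul, coeff_X_mul, coeff_X_mul,
        coeff_derivative]
      cases n with
      | zero =>
        rw [coeff_X_mul_zero]
        push_cast
        ring
      | succ n =>
        rw [coeff_X_mul, coeff_derivative]
        push_cast
        ring
    have hne : p.coeff (q.natDegree + 1) ≠ 0 := by
      rw [hcoeff, coeff_eq_zero_of_natDegree_lt (show q.natDegree < q.natDegree + 2 by omega),
        zero_mul, mul_zero, zero_sub]
      exact neg_ne_zero.2 (mul_ne_zero (Nat.cast_ne_zero.2 (by omega)) (by simpa using hq0))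
    have hdeg : p.natDegree = q.natDegree + 1 := by
      refine le_antisymm ?_ (le_natDegree_of_ne_zero hne)
      refine natDegree_le_iff_coeff_eq_zero.2 fun N hN => ?_
      obtain ⟨n, rfl⟩ : ∃ n, N = n + 1 := ⟨N - 1, by omega⟩
      rw [hcoeff, coeff_eq_zero_of_natDegree_lt (show q.natDegree < n + 2 by omega),
        coeff_eq_zero_of_natDegree_lt (show q.natDegree < n by omega)]
      simp
    have hmem : u ^ m * aeval w p ∈ A := by
      refine h.mem_of_dvd_sub (h.closed _ h.v_mem _ hq) ⟨u ^ m * aeval w (derivative q), ?_⟩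
      simp only [hp, Derivation.leibniz, Derivation.leibniz_pow, Derivation.map_aeval, h.br_v_w,
        h.br_v_u, smul_eq_mul, nsmul_eq_mul, add_tsub_cancel_right, map_sub, map_mul, map_add,
        map_pow, aeval_X, aeval_C, map_natCast, map_one, map_ofNat]
      push_cast
      ring
    obtain ⟨r, hr, hrd⟩ := ih (q := p) (by rintro h0; simp [h0] at hdeg) hmem
    exact ⟨r, hr, by omega⟩

/-- The linear map sending a finite family `(q i)` of polynomials to the sum of the elements
`u ^ i * q i (w)` for `i ≥ 0` and `v ^ (-i) * q i (w)` for `i ≤ 0`. -/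
noncomputable def weightSum (u v w : R) : (ℤ →₀ ℂ[X]) →ₗ[ℂ] R :=
  Finsupp.lsum ℂ fun i =>
    (LinearMap.mulLeft ℂ (u ^ i.toNat * v ^ (-i).toNat)).comp (aeval w).toLinearMap

theorem weightSum_apply (u v w : R) (f : ℤ →₀ ℂ[X]) :
    weightSum u v w f =
      ∑ i ∈ f.support, u ^ i.toNat * v ^ (-i).toNat * aeval w (f i) := rfl

theorem weightSum_single (u v w : R) (i : ℤ) (q : ℂ[X]) :
    weightSum u v w (Finsupp.single i q) = u ^ i.toNat * v ^ (-i).toNat * aeval w q := by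
  simp [weightSum, mul_assoc]

theorem monomial_mem_range_sup (c : ℂ) (u v w : R) (a b k : ℕ) :
    u ^ a * v ^ b * w ^ k ∈ LinearMap.range (weightSum u v w) ⊔
      (Ideal.span {u * v - (algebraMap ℂ R c - w ^ 2)}).restrictScalars ℂ := by
  -- Here `n` is `min a b` and `i` is the weight `a - b`.
  have key : ∀ (n : ℕ) (i : ℤ),
      (u * v) ^ n * (u ^ i.toNat * v ^ (-i).toNat * w ^ k) ∈
      LinearMap.range (weightSum u v w) ⊔
      (Ideal.span {u * v - (algebraMap ℂ R c - w ^ 2)}).restrictScalars ℂ := by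
    intro n i
    refine Submodule.mem_sup.2 ⟨_, ⟨Finsupp.single i ((C c - X ^ 2) ^ n * X ^ k), rfl⟩,
      ((u * v) ^ n - (algebraMap ℂ R c - w ^ 2) ^ n) * (u ^ i.toNat * v ^ (-i).toNat * w ^ k),
      ?_, ?_⟩
    · exact Ideal.mul_mem_right _ _ (Ideal.mem_span_singleton.2 (sub_dvd_pow_sub_pow _ _ n))
    · rw [weightSum_single]
      simp only [map_mul, map_pow, map_sub, aeval_C, aeval_X]
      ring
  rcases le_total b a with hab | hab
  · obtain ⟨e, rfl⟩ := Nat.exists_eq_add_of_le hab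
    convert key b e using 1
    simp
    ring
  · obtain ⟨e, rfl⟩ := Nat.exists_eq_add_of_le hab
    convert key a (-e) using 1
    simp
    ring

theorem br_w_weight (h : IsSphereSubalgebra br c A u v w) (i : ℤ) (q : ℂ[X]) :
    br w (u ^ i.toNat * v ^ (-i).toNat * aeval w q) =
      (i : ℂ) • (u ^ i.toNat * v ^ (-i).toNat * aeval w q) := by
  have key (n : ℕ) (x : R) : (n : R) * (x ^ (n - 1) * x) = n * x ^ n := by
    cases n <;> simp [pow_succ]
  obtain ⟨n, rfl | rfl⟩ := i.eq_nat_or_neg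
  · simp only [Int.toNat_natCast, Int.toNat_neg_natCast, pow_zero, mul_one, Derivation.leibniz,
      Derivation.leibniz_pow, Derivation.map_aeval, h.br_self, h.br_w_u, smul_eq_mul,
      Algebra.smul_def, Int.cast_natCast, map_natCast]
    linear_combination aeval w q * key n u
  · simp only [Int.toNat_natCast, Int.toNat_neg_natCast, pow_zero, one_mul, Derivation.leibniz,
      Derivation.leibniz_pow, Derivation.map_aeval, h.br_self, h.br_w_v, smul_eq_mul,
      Algebra.smul_def, Int.cast_natCast, map_natCast, neg_neg, Int.cast_neg,
      map_neg]
    linear_combination (-aeval w q) * key n v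

/-- The degree obtained is `m + natDegree q`; were it at most 1, the weight vector would be a
combination of `1`, `u`, `w`, hence in `B`. -/
theorem exists_aeval_mem_of_weight (h : IsSphereSubalgebra br c A u v w) {B : Submodule ℂ R}
    (h1 : 1 ∈ B) (hu : u ∈ B) (hw : w ∈ B) (m : ℕ) {q : ℂ[X]}
    (hA : u ^ m * aeval w q ∈ A) (hB : u ^ m * aeval w q ∉ B) :
    ∃ p : ℂ[X], aeval w p ∈ A ∧ 2 ≤ p.natDegree := by
  have hq0 : q ≠ 0 := by rintro rfl; simp at hB
  obtain ⟨p, hp, hpd⟩ := h.exists_aeval_mem_of_pow_mul m hq0 hA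
  refine ⟨p, hp, ?_⟩
  by_contra! hlt
  apply hB
  rw [hpd] at hlt
  have hq1 : q.natDegree ≤ 1 := by omega
  rcases Nat.eq_zero_or_pos m with rfl | hm
  · rw [eq_X_add_C_of_natDegree_le_one hq1]
    simp only [map_add, map_mul, aeval_C, aeval_X, pow_zero, one_mul]
    rw [← Algebra.smul_def, Algebra.algebraMap_eq_smul_one]
    exact B.add_mem (B.smul_mem _ hw) (B.smul_mem _ h1)
  · obtain rfl : m = 1 := by omega
    rw [eq_C_of_natDegree_le_zero (show q.natDegree ≤ 0 by omega), aeval_C, mul_comm,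
      ← Algebra.smul_def, pow_one]
    exact B.smul_mem _ hu

theorem exists_aeval_mem_of_not_mem (h : IsSphereSubalgebra br c A u v w) {B : Submodule ℂ R}
    (h1 : 1 ∈ B) (hu : u ∈ B) (hv : v ∈ B) (hw : w ∈ B)
    (hrel : ∀ x, x * (u * v - (algebraMap ℂ R c - w ^ 2)) ∈ B)
    {x : R} (hx : x ∈ Submodule.span ℂ {y | ∃ a b k : ℕ, y = u ^ a * v ^ b * w ^ k})
    (hA : x ∈ A) (hB : x ∉ B) :
    ∃ p : ℂ[X], aeval w p ∈ A ∧ 2 ≤ p.natDegree := by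
  have hle : Submodule.span ℂ {y | ∃ a b k : ℕ, y = u ^ a * v ^ b * w ^ k} ≤
      LinearMap.range (weightSum u v w) ⊔
      (Ideal.span {u * v - (algebraMap ℂ R c - w ^ 2)}).restrictScalars ℂ := by
    rw [Submodule.span_le]
    rintro _ ⟨a, b, k, rfl⟩
    exact monomial_mem_range_sup c u v w a b k
  obtain ⟨_, ⟨f, rfl⟩, z, hz, rfl⟩ := Submodule.mem_sup.1 (hle hx)
  obtain ⟨t, rfl⟩ := Ideal.mem_span_singleton'.1 hz
  replace hA := (A.add_mem_iff_left (h.rel_mem t)).1 hA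
  replace hB := fun hf => hB (B.add_mem hf (hrel t))
  rw [weightSum_apply] at hA hB
  have hmem := Submodule.mem_of_sum_eigenvectors_mem (br w).toLinearMap A
    (fun x hx => h.closed _ h.w_mem _ hx) (fun i : ℤ => (i : ℂ)) Int.cast_injective f.support
    (fun i => u ^ i.toNat * v ^ (-i).toNat * aeval w (f i))
    (fun i _ => h.br_w_weight i (f i)) hA
  obtain ⟨i, hi, hiB⟩ : ∃ i ∈ f.support, u ^ i.toNat * v ^ (-i).toNat * aeval w (f i) ∉ B := by
    by_contra! hall
    exact hB (B.sum_mem hall)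
  have hiA := hmem i hi
  obtain ⟨n, rfl | rfl⟩ := i.eq_nat_or_neg
  · simp only [Int.toNat_natCast, Int.toNat_neg_natCast, pow_zero, mul_one] at hiA hiB
    exact h.exists_aeval_mem_of_weight h1 hu hw n hiA hiB
  -- Negative weights become positive under `swap`.
  · have hcomp : aeval (-w) ((f (-n)).comp (-X)) = aeval w (f (-n)) := by
      simp [Polynomial.aeval_comp]
    simp only [neg_neg, Int.toNat_natCast, Int.toNat_neg_natCast, pow_zero, one_mul] at hiA hiB
    rw [← hcomp] at hiA hiB
    obtain ⟨p, hp, hpd⟩ :=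
      h.swap.exists_aeval_mem_of_weight h1 hv (B.neg_mem hw) n hiA hiB
    exact ⟨p.comp (-X), by simpa [Polynomial.aeval_comp] using hp,
      by simpa [Polynomial.natDegree_comp] using hpd⟩

end IsSphereSubalgebra

/-! ### Complexification of the sphere algebra. -/

namespace SpinSphere

open MvPolynomial

/-- The inclusion of the real polynomials into the complex ones. -/
noncomputable abbrev ofRealPoly : MvPolynomial (Fin 3) ℝ →+* MvPolynomial (Fin 3) ℂ :=
  MvPolynomial.map (algebraMap ℝ ℂ)

theorem C_I_mul_C_I : (C Complex.I * C Complex.I : MvPolynomial (Fin 3) ℂ) = -1 := by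
  rw [← C_mul, Complex.I_mul_I, map_neg, map_one]

/-- The complex polynomials whose real and imaginary parts have their classes in `A`. -/
noncomputable def complexify (s : ℝ) (A : Submodule ℝ (SpherePolynomial s)) :
    Submodule ℂ (MvPolynomial (Fin 3) ℂ) where
  carrier := {F | ∃ f g, toSphere s f ∈ A ∧ toSphere s g ∈ A ∧
    F = ofRealPoly f + C Complex.I * ofRealPoly g}
  zero_mem' := ⟨0, 0, by simp, by simp, by simp⟩
  add_mem' := by
    rintro _ _ ⟨f, g, hf, hg, rfl⟩ ⟨f', g', hf', hg', rfl⟩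
    refine ⟨f + f', g + g', ?_, ?_, ?_⟩
    · rw [map_add]; exact A.add_mem hf hf'
    · rw [map_add]; exact A.add_mem hg hg'
    · simp only [map_add]; ring
  smul_mem' := by
    rintro z _ ⟨f, g, hf, hg, rfl⟩
    refine ⟨z.re • f - z.im • g, z.im • f + z.re • g, ?_, ?_, ?_⟩
    · rw [map_sub, map_smul, map_smul]
      exact A.sub_mem (A.smul_mem _ hf) (A.smul_mem _ hg)
    · rw [map_add, map_smul, map_smul]
      exact A.add_mem (A.smul_mem _ hf) (A.smul_mem _ hg)
    · have hz : (C z : MvPolynomial (Fin 3) ℂ) = C (z.re : ℂ) + C Complex.I * C (z.im : ℂ) := by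
        rw [← C_mul, ← C_add, mul_comm, Complex.re_add_im]
      simp only [smul_eq_C_mul, map_add, map_sub, map_mul, MvPolynomial.map_C, hz,
        Complex.coe_algebraMap]
      linear_combination (C (z.im : ℂ) * ofRealPoly g) * C_I_mul_C_I

theorem exists_re_im (F : MvPolynomial (Fin 3) ℂ) :
    ∃ f g, F = ofRealPoly f + C Complex.I * ofRealPoly g := by
  -- With `⊤` the membership conditions are void, so only complex linearity is used; the radius 0 is
  -- arbitrary.
  have h : F ∈ complexify 0 ⊤ := by
    have hI : ∀ f, ofRealPoly f ∈ complexify 0 ⊤ := fun f => ⟨f, 0, by simp, by simp, by simp⟩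
    rw [F.as_sum]
    refine Submodule.sum_mem _ fun d _ => ?_
    have h1 := (complexify 0 ⊤).smul_mem (coeff d F) (hI (monomial d 1))
    simpa [smul_monomial] using h1
  obtain ⟨f, g, -, -, h⟩ := h
  exact ⟨f, g, h⟩

theorem ofRealPoly_mem_complexify {s : ℝ} {A : Submodule ℝ (SpherePolynomial s)}
    {f : MvPolynomial (Fin 3) ℝ} : ofRealPoly f ∈ complexify s A ↔ toSphere s f ∈ A := by
  refine ⟨?_, fun h => ⟨f, 0, h, by simp, by simp⟩⟩
  rintro ⟨a, b, ha, -, h⟩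
  suffices f = a by rwa [this]
  ext d
  have h1 := congrArg (fun F => (coeff d F).re) h
  simpa [coeff_C_mul, MvPolynomial.coeff_map] using h1

/-- The bracket of complex polynomials, multiplied by `i`, as a derivation in its second
argument. -/
noncomputable def complexBracket (F : MvPolynomial (Fin 3) ℂ) :
    Derivation ℂ (MvPolynomial (Fin 3) ℂ) (MvPolynomial (Fin 3) ℂ) :=
  (C Complex.I * (X 1 * pderiv 2 F - X 2 * pderiv 1 F)) • pderiv 0 +
  (C Complex.I * (X 2 * pderiv 0 F - X 0 * pderiv 2 F)) • pderiv 1 +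
  (C Complex.I * (X 0 * pderiv 1 F - X 1 * pderiv 0 F)) • pderiv 2

theorem complexBracket_apply (F G : MvPolynomial (Fin 3) ℂ) :
    complexBracket F G = C Complex.I *
      (X 0 * (pderiv 1 F * pderiv 2 G - pderiv 2 F * pderiv 1 G) +
      X 1 * (pderiv 2 F * pderiv 0 G - pderiv 0 F * pderiv 2 G) +
      X 2 * (pderiv 0 F * pderiv 1 G - pderiv 1 F * pderiv 0 G)) := by
  simp only [complexBracket, Derivation.add_apply, Derivation.smul_apply, smul_eq_mul]
  ring

theorem complexBracket_mem {s : ℝ} {A : Submodule ℝ (SpherePolynomial s)}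
    (hA : IsPoissonSubalgebra s A) {F G : MvPolynomial (Fin 3) ℂ}
    (hF : F ∈ complexify s A) (hG : G ∈ complexify s A) :
    complexBracket F G ∈ complexify s A := by
  obtain ⟨a, b, ha, hb, rfl⟩ := hF
  obtain ⟨a', b', ha', hb', rfl⟩ := hG
  have hbr : ∀ {x y}, toSphere s x ∈ A → toSphere s y ∈ A →
      ofRealPoly (polyBracket x y) ∈ complexify s A := fun hx hy =>
    ofRealPoly_mem_complexify.2 (by rw [← poissonBracket_toSphere]; exact hA _ hx _ hy)
  have key : complexBracket (ofRealPoly a + C Complex.I * ofRealPoly b)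
      (ofRealPoly a' + C Complex.I * ofRealPoly b') =
      Complex.I • ((ofRealPoly (polyBracket a a') - ofRealPoly (polyBracket b b')) +
        Complex.I • (ofRealPoly (polyBracket a b') + ofRealPoly (polyBracket b a'))) := by
    simp only [complexBracket_apply, smul_eq_C_mul, polyBracket, map_add, map_mul, map_sub,
      MvPolynomial.map_X, ← pderiv_map, pderiv_C_mul]
    linear_combination (C Complex.I *
      (X 0 * (pderiv 1 (ofRealPoly b) * pderiv 2 (ofRealPoly b') -
        pderiv 2 (ofRealPoly b) * pderiv 1 (ofRealPoly b')) +
      X 1 * (pderiv 2 (ofRealPoly b) * pderiv 0 (ofRealPoly b') -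
        pderiv 0 (ofRealPoly b) * pderiv 2 (ofRealPoly b')) +
      X 2 * (pderiv 0 (ofRealPoly b) * pderiv 1 (ofRealPoly b') -
        pderiv 1 (ofRealPoly b) * pderiv 0 (ofRealPoly b')))) * C_I_mul_C_I
  rw [key]
  refine Submodule.smul_mem _ _ (Submodule.add_mem _ (Submodule.sub_mem _ (hbr ha ha') (hbr hb hb'))
    (Submodule.smul_mem _ _ (Submodule.add_mem _ (hbr ha hb') (hbr hb ha'))))

/-- The raising element `S₁ + i S₂`. -/
noncomputable def raising : MvPolynomial (Fin 3) ℂ := X 0 + C Complex.I * X 1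

/-- The lowering element `S₁ - i S₂`. -/
noncomputable def lowering : MvPolynomial (Fin 3) ℂ := X 0 - C Complex.I * X 1

theorem raising_mul_lowering_sub (s : ℝ) :
    raising * lowering - (algebraMap ℂ (MvPolynomial (Fin 3) ℂ) ((s : ℂ) ^ 2) - X 2 ^ 2) =
      ofRealPoly (spherePoly s) := by
  simp only [raising, lowering, spherePoly, map_add, map_sub, map_pow, MvPolynomial.map_X,
    MvPolynomial.map_C, MvPolynomial.algebraMap_eq, Complex.coe_algebraMap]
  linear_combination (-X 1 ^ 2) * C_I_mul_C_I

/-- Real and imaginary parts of a multiple of the relation have class zero, so the ideal lies in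
every complexified subspace. -/
theorem mul_relation_mem_complexify (s : ℝ) (A : Submodule ℝ (SpherePolynomial s))
    (F : MvPolynomial (Fin 3) ℂ) :
    F * (raising * lowering - (algebraMap ℂ (MvPolynomial (Fin 3) ℂ) ((s : ℂ) ^ 2) - X 2 ^ 2)) ∈
      complexify s A := by
  obtain ⟨f, g, rfl⟩ := exists_re_im F
  have h0 : ∀ f, toSphere s (f * spherePoly s) = 0 := fun f =>
    Ideal.Quotient.eq_zero_iff_mem.2 (Ideal.mem_span_singleton'.2 ⟨f, rfl⟩)
  refine ⟨f * spherePoly s, g * spherePoly s, ?_, ?_, ?_⟩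
  · rw [h0]; exact A.zero_mem
  · rw [h0]; exact A.zero_mem
  · rw [raising_mul_lowering_sub, map_mul, map_mul]
    ring

theorem X_mem_complexify {s : ℝ} {A : Submodule ℝ (SpherePolynomial s)} (h : degreeLE s 1 ≤ A)
    (i : Fin 3) : (X i : MvPolynomial (Fin 3) ℂ) ∈ complexify s A := by
  have h1 : ofRealPoly (X i) ∈ complexify s A := by
    refine ofRealPoly_mem_complexify.2 (h ⟨X i, ?_, rfl⟩)
    exact (mem_restrictTotalDegree _ _ _).2 (totalDegree_X i).le
  simpa using h1

theorem one_mem_complexify {s : ℝ} {A : Submodule ℝ (SpherePolynomial s)} (h : degreeLE s 1 ≤ A) :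
    (1 : MvPolynomial (Fin 3) ℂ) ∈ complexify s A := by
  have h1 : ofRealPoly 1 ∈ complexify s A := by
    refine ofRealPoly_mem_complexify.2 (h ⟨1, ?_, rfl⟩)
    exact (mem_restrictTotalDegree _ _ _).2 (by simp)
  simpa using h1

theorem raising_mem_complexify {s : ℝ} {A : Submodule ℝ (SpherePolynomial s)}
    (h : degreeLE s 1 ≤ A) : raising ∈ complexify s A := by
  rw [raising, ← smul_eq_C_mul]
  exact Submodule.add_mem _ (X_mem_complexify h 0) (Submodule.smul_mem _ _ (X_mem_complexify h 1))

theorem lowering_mem_complexify {s : ℝ} {A : Submodule ℝ (SpherePolynomial s)}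
    (h : degreeLE s 1 ≤ A) : lowering ∈ complexify s A := by
  rw [lowering, ← smul_eq_C_mul]
  exact Submodule.sub_mem _ (X_mem_complexify h 0) (Submodule.smul_mem _ _ (X_mem_complexify h 1))

theorem isSphereSubalgebra_complexify {s : ℝ} (hs : 0 < s)
    {A : Submodule ℝ (SpherePolynomial s)} (hA : IsPoissonSubalgebra s A)
    (h : degreeLE s 1 ≤ A) :
    IsSphereSubalgebra complexBracket ((s : ℂ) ^ 2) (complexify s A) raising lowering (X 2) where
  skew F G := by
    simp only [complexBracket_apply]
    ring
  closed F hF G hG := complexBracket_mem hA hF hG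
  u_mem := raising_mem_complexify h
  v_mem := lowering_mem_complexify h
  w_mem := X_mem_complexify h 2
  rel_mem := mul_relation_mem_complexify s A
  br_w_u := by
    simp [complexBracket_apply, raising, pderiv_X]
    linear_combination (-X 0) * C_I_mul_C_I
  br_w_v := by
    simp [complexBracket_apply, lowering, pderiv_X]
    linear_combination (X 0) * C_I_mul_C_I
  br_u_v := by
    simp [complexBracket_apply, raising, lowering, pderiv_X]
    linear_combination (-2 * X 2) * C_I_mul_C_I
  ne_zero := pow_ne_zero _ (Complex.ofReal_ne_zero.2 hs.ne')

/-! ### Ladder monomials by degree, and the conclusion. -/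

/-- The span of the products of `n` factors among `S₁ + i S₂`, `S₁ - i S₂` and `S₃`. -/
noncomputable def ladderSpan (n : ℕ) : Submodule ℂ (MvPolynomial (Fin 3) ℂ) :=
  Submodule.span ℂ {y | ∃ a b k : ℕ, a + b + k = n ∧ y = raising ^ a * lowering ^ b * X 2 ^ k}

theorem X_mul_mem_ladderSpan (i : Fin 3) {n : ℕ} {F : MvPolynomial (Fin 3) ℂ}
    (hF : F ∈ ladderSpan n) : X i * F ∈ ladderSpan (n + 1) := by
  have hmul : ∀ z, (∀ a b k : ℕ, a + b + k = n →
      z * (raising ^ a * lowering ^ b * X 2 ^ k) ∈ ladderSpan (n + 1)) →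
      ∀ F ∈ ladderSpan n, z * F ∈ ladderSpan (n + 1) := by
    intro z hz
    change ladderSpan n ≤ (ladderSpan (n + 1)).comap (LinearMap.mulLeft ℂ z)
    rw [ladderSpan, Submodule.span_le]
    rintro _ ⟨a, b, k, hn, rfl⟩
    exact hz a b k hn
  have hu := hmul raising (fun a b k hn =>
    Submodule.subset_span ⟨a + 1, b, k, by omega, by ring⟩) F hF
  have hv := hmul lowering (fun a b k hn =>
    Submodule.subset_span ⟨a, b + 1, k, by omega, by ring⟩) F hF
  have hw := hmul (X 2) (fun a b k hn =>
    Submodule.subset_span ⟨a, b, k + 1, by omega, by ring⟩) F hF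
  fin_cases i
  · have h1 := (ladderSpan (n + 1)).add_mem hu hv
    have h2 : raising * F + lowering * F = (2 : ℂ) • (X 0 * F) := by
      rw [smul_eq_C_mul, raising, lowering, map_ofNat]; ring
    rw [h2] at h1
    exact ((ladderSpan (n + 1)).smul_mem_iff two_ne_zero).1 h1
  · have h1 := (ladderSpan (n + 1)).sub_mem hu hv
    have h2 : raising * F - lowering * F = (2 * Complex.I : ℂ) • (X 1 * F) := by
      rw [smul_eq_C_mul, raising, lowering, C_mul, map_ofNat]; ring
    rw [h2] at h1
    exact ((ladderSpan (n + 1)).smul_mem_iff (mul_ne_zero two_ne_zero Complex.I_ne_zero)).1 h1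
  · exact hw

theorem monomial_mem_ladderSpan (d : Fin 3 →₀ ℕ) (z : ℂ) :
    monomial d z ∈ ladderSpan d.degree := by
  have hX : ∀ (i : Fin 3) (m n : ℕ) (F), F ∈ ladderSpan n → X i ^ m * F ∈ ladderSpan (m + n) := by
    intro i m n F hF
    induction m with
    | zero => simpa using hF
    | succ m ih =>
      rw [pow_succ', mul_assoc, show m + 1 + n = m + n + 1 by ring]
      exact X_mul_mem_ladderSpan i ih
  have h0 : (1 : MvPolynomial (Fin 3) ℂ) ∈ ladderSpan 0 :=
    Submodule.subset_span ⟨0, 0, 0, rfl, by simp⟩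
  have h1 := hX 0 (d 0) _ _ (hX 1 (d 1) _ _ (hX 2 (d 2) _ _ h0))
  rw [monomial_eq, ← smul_eq_C_mul, Finsupp.prod_fintype _ _ (by simp), Finsupp.degree_eq_sum,
    Fin.prod_univ_three, Fin.sum_univ_three]
  refine Submodule.smul_mem _ _ ?_
  convert h1 using 1
  · rw [add_zero, add_assoc]
  · ring

theorem oddTilde_le_of_degreeLE_lt (s : ℝ) (hs : 0 < s)
    (A : Submodule ℝ (SpherePolynomial s))
    (hA : IsPoissonSubalgebra s A)
    (hlt : degreeLE s 1 < A) :
    oddTilde s ≤ A := by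
  have h := isSphereSubalgebra_complexify hs hA hlt.le
  obtain ⟨x, hxA, hxB⟩ := SetLike.exists_of_lt hlt
  obtain ⟨f, rfl⟩ := Ideal.Quotient.mk_surjective x
  have hspan : ofRealPoly f ∈ Submodule.span ℂ
      {y | ∃ a b k : ℕ, y = raising ^ a * lowering ^ b * X 2 ^ k} := by
    rw [(ofRealPoly f).as_sum]
    refine Submodule.sum_mem _ fun d _ => ?_
    refine Submodule.span_mono ?_ (monomial_mem_ladderSpan d _)
    rintro _ ⟨a, b, k, -, rfl⟩
    exact ⟨a, b, k, rfl⟩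
  -- The subspace `B` is the complexification of `𝒫¹`.
  obtain ⟨q, hq, hd⟩ := h.exists_aeval_mem_of_not_mem (one_mem_complexify le_rfl)
    (raising_mem_complexify le_rfl) (lowering_mem_complexify le_rfl) (X_mem_complexify le_rfl 2)
    (mul_relation_mem_complexify s _) hspan (ofRealPoly_mem_complexify.2 hxA)
    (fun hf => hxB (ofRealPoly_mem_complexify.1 hf))
  refine sup_le ?_ ?_
  · rintro _ ⟨g, hg, rfl⟩
    refine ofRealPoly_mem_complexify.1 ?_
    rw [(ofRealPoly g).as_sum]
    refine Submodule.sum_mem _ fun d hdg => ?_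
    have hodd : Odd d.degree := hg d (support_map_subset _ _ hdg)
    -- The change to ladder variables preserves degree, so odd monomials only involve odd ladder
    -- monomials.
    have hle : ladderSpan d.degree ≤ complexify s A := by
      rw [ladderSpan, Submodule.span_le]
      rintro _ ⟨a, b, k, hn, rfl⟩
      exact h.odd_monomial_mem hq hd a b k (hn ▸ hodd)
    exact hle (monomial_mem_ladderSpan d _)
  · rw [Submodule.span_singleton_le_iff_mem]
    refine hlt.le ⟨1, ?_, map_one (toSphere s)⟩
    exact (mem_restrictTotalDegree _ _ _).2 (by simp)

end SpinSphere

theorem mainTheorem7 (s : ℝ) (hs : 0 < s)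
    (A : Submodule ℝ (SpinSphere.SpherePolynomial s))
    (hA : SpinSphere.IsPoissonSubalgebra s A)
    (hlt : SpinSphere.degreeLE s 1 < A) :
    SpinSphere.oddTilde s ≤ A :=
  SpinSphere.oddTilde_le_of_degreeLE_lt s hs A hA hlt
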